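/- Let $S$ be a submonoid of $\mathbb N^r$ minimally generated by a finite set $\mathcal A=\{\mathbf a_1,\dots,\mathbf a_p\}$ (that is, $\mathcal A$ generates $S$ and no proper subset of $\mathcal A$ does), and let $\mathbf d\in S$ be nonzero. Let $\pi_{\mathcal A}:\mathbb N^p\to S$, $\mathbf u\mapsto\sum_i u_i\mathbf a_i$, let $\mathsf Z(\mathbf s)=\pi_{\mathcal A}^{-1}(\mathbf s)$ be the set of factorizations of $\mathbf s \in S$, and let $\equiv_{\mathcal A}\,\subseteq\mathbb N^p\times\mathbb N^p$ be the kernel congruence of $\pi_{\mathcal A}$. A presentation of $S$ is a subset of $\mathbb N^p\times\mathbb N^p$ that generates $\equiv_{\mathcal A}$ as a congruence; it is minimal if no proper subset of it is a presentation. $\mathrm{Betti}(S)$ is the set of all $\pi_{\mathcal A}(\mathbf u)$ with $(\mathbf u,\mathbf v)$ in a minimal presentation of $S$ (it depends neither on the minimal presentation nor on $\mathcal A$, which is determined by $S$). A circuit is a nonzero pair $(\mathbf u,\mathbf v)$ in $\equiv_{\mathcal A}$ such that $\mathbf u$ and $\mathbf v$ have disjoint supports, $\mathrm{supp}(\mathbf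 u)\cup\mathrm{supp}(\mathbf v)$ is minimal with respect to inclusion among the nonzero pairs of $\equiv_{\mathcal A}$ with disjoint supports, and the coordinates of $(\mathbf u,\mathbf v)$ have greatest common divisor $1$; $\mathcal C_{\mathcal A}$ is the set of circuits. The Graver basis $\mathrm{Gr}_{\mathcal A}$ is the set of minimal elements of $\equiv_{\mathcal A}\setminus\{(0,0)\}$ for the componentwise order on $\mathbb N^p\times\mathbb N^p$, with the pairs $(\mathbf e_1,\mathbf e_1),\dots,(\mathbf e_p,\mathbf e_p)$ removed. $S$ is the gluing of $S_1$ and $S_2$ by $\mathbf d$ if $\mathcal A$ is the disjoint union of nonempty sets $\mathcal A_1,\mathcal A_2$ such that $S_1,S_2$ are the monoids generated by $\mathcal A_1,\mathcal A_2$, respectively, $\mathbf d\in (S_1\cap S_2)\setminus\{0\}$, and $\mathbb Z\mathcal A_1\cap\mathbb Z\mathcal A_2=\mathbb Z\mathbf d$ in $\mathbb Z^r$. The following are equivalent: (a) $\mathrm{Betti}(S)=\{\mathbf d\}$. (b) $\mathcal C_{\mathcal A}=\mathsf Z(\mathbf d)\times\mathsf Z(\mathbf d)\setminus\{(\mathbf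 u,\mathbf u)\mid\pi_{\mathcal A}(\mathbf u)=\mathbf d\}=\mathrm{Gr}_{\mathcal A}$, and this set is nonempty. (c) $S$ is the gluing of some $S_1$ and $S_2$ by $\mathbf d$, with $\mathrm{Betti}(S_1)\cup\mathrm{Betti}(S_2)\subseteq\{\mathbf d\}$. -/

import Mathlib

namespace AffineSemigroup

/-- `A` is a minimal generating set of the monoid `S`: it generates `S`, and no proper subset of
`A` does. -/
def MinimallyGenerates {r : ℕ} (A : Finset (Fin r → ℕ)) (S : AddSubmonoid (Fin r → ℕ)) : Prop :=
  AddSubmonoid.closure (A : Set (Fin r → ℕ)) = S ∧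
    ∀ B : Finset (Fin r → ℕ), B ⊂ A → AddSubmonoid.closure (B : Set (Fin r → ℕ)) ≠ S

/-- The factorization homomorphism `π_A : ℕ^A → ℕ^r`, `u ↦ ∑_{a ∈ A} u_a a`. -/
def piHom {r : ℕ} (A : Finset (Fin r → ℕ)) : (A → ℕ) →+ (Fin r → ℕ) where
  toFun u := ∑ a : A, u a • (a : Fin r → ℕ)
  map_zero' := by simp
  map_add' u v := by simp [add_smul, Finset.sum_add_distrib]

/-- The set `Z(s)` of factorizations of `s`. -/
def factorizations {r : ℕ} (A : Finset (Fin r → ℕ)) (s : Fin r → ℕ) : Set (A → ℕ) :=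
  {u | piHom A u = s}

/-- The kernel congruence `≡_A` of the factorization homomorphism. -/
def kerCon {r : ℕ} (A : Finset (Fin r → ℕ)) : AddCon (A → ℕ) :=
  AddCon.ker (piHom A)

/-- `σ` is a presentation (relative to `A`): the congruence it generates is `≡_A`. -/
def IsPresentation {r : ℕ} (A : Finset (Fin r → ℕ)) (σ : Set ((A → ℕ) × (A → ℕ))) : Prop :=
  addConGen (fun u v => (u, v) ∈ σ) = kerCon A

/-- A presentation is minimal if no proper subset of it is a presentation. -/
def IsMinimalPresentation {r : ℕ} (A : Finset (Fin r → ℕ))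
    (σ : Set ((A → ℕ) × (A → ℕ))) : Prop :=
  IsPresentation A σ ∧ ∀ τ : Set ((A → ℕ) × (A → ℕ)), τ ⊂ σ → ¬ IsPresentation A τ

/-- The Betti elements of `S`: the elements `π_A(u)` with `(u, v)` in a minimal presentation of
`S` relative to its minimal generating set `A`. (Neither the choice of the minimal presentation
nor that of `A`, which is unique, matters.) -/
def betti {r : ℕ} (S : AddSubmonoid (Fin r → ℕ)) : Set (Fin r → ℕ) :=
  {b | ∃ A : Finset (Fin r → ℕ), MinimallyGenerates A S ∧
    ∃ σ : Set ((A → ℕ) × (A → ℕ)), IsMinimalPresentation A σ ∧ ∃ q ∈ σ, piHom A q.1 = b}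

/-- The pairs of distinct factorizations of `d`: `Z(d) × Z(d) ∖ {(u, u) | π_A(u) = d}`. -/
def distinctFactorizationPairs {r : ℕ} (A : Finset (Fin r → ℕ)) (d : Fin r → ℕ) :
    Set ((A → ℕ) × (A → ℕ)) :=
  (factorizations A d ×ˢ factorizations A d) \ {q | ∃ u, piHom A u = d ∧ q = (u, u)}

/-- The irreducible elements of `≡_A`: the minimal elements of `≡_A ∖ {(0, 0)}` for the
componentwise order on `ℕ^A × ℕ^A`. -/
def irreducibles {r : ℕ} (A : Finset (Fin r → ℕ)) : Set ((A → ℕ) × (A → ℕ)) :=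
  {q | Minimal (fun q' : (A → ℕ) × (A → ℕ) => kerCon A q'.1 q'.2 ∧ q' ≠ 0) q}

/-- The Graver basis: the irreducible elements other than the pairs `(e_a, e_a)`. -/
def graver {r : ℕ} (A : Finset (Fin r → ℕ)) : Set ((A → ℕ) × (A → ℕ)) :=
  irreducibles A \ Set.range (fun a : A => ((Pi.single a 1, Pi.single a 1) : (A → ℕ) × (A → ℕ)))

/-- Nonzero elements of `≡_A` whose two components have disjoint support. -/
def IsDisjointRelation {r : ℕ} (A : Finset (Fin r → ℕ)) (q : (A → ℕ) × (A → ℕ)) : Prop :=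
  kerCon A q.1 q.2 ∧ q ≠ 0 ∧ Disjoint (Function.support q.1) (Function.support q.2)

/-- The circuits of `≡_A`: nonzero pairs `(u, v)` in `≡_A` with disjoint supports, with
`supp u ∪ supp v` minimal for inclusion (among all such pairs), and with relatively prime
coordinates. -/
def circuits {r : ℕ} (A : Finset (Fin r → ℕ)) : Set ((A → ℕ) × (A → ℕ)) :=
  {q | IsDisjointRelation A q ∧
    (∀ q' : (A → ℕ) × (A → ℕ), IsDisjointRelation A q' →
      ¬ (Function.support q'.1 ∪ Function.support q'.2 ⊂
          Function.support q.1 ∪ Function.support q.2)) ∧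
    Nat.gcd (Finset.univ.gcd q.1) (Finset.univ.gcd q.2) = 1}

/-- The inclusion `ℕ^r → ℤ^r`. -/
def toInt {r : ℕ} (x : Fin r → ℕ) : Fin r → ℤ := fun i => (x i : ℤ)

/-- The subgroup `ℤA` of `ℤ^r` generated by `A`. -/
def intSpan {r : ℕ} (A : Finset (Fin r → ℕ)) : AddSubgroup (Fin r → ℤ) :=
  AddSubgroup.closure (toInt '' (A : Set (Fin r → ℕ)))

/-- The semigroup minimally generated by `A` is the gluing of `S₁` and `S₂` by `d`: `A` is the
disjoint union of nonempty sets `A₁`, `A₂` that generate `S₁`, `S₂`, the nonzero element `d` lies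
in `S₁ ∩ S₂`, and `ℤA₁ ∩ ℤA₂ = ℤd`. -/
def IsGluing {r : ℕ} (A : Finset (Fin r → ℕ)) (S₁ S₂ : AddSubmonoid (Fin r → ℕ))
    (d : Fin r → ℕ) : Prop :=
  ∃ A₁ A₂ : Finset (Fin r → ℕ), A₁.Nonempty ∧ A₂.Nonempty ∧ Disjoint A₁ A₂ ∧ A₁ ∪ A₂ = A ∧
    S₁ = AddSubmonoid.closure (A₁ : Set (Fin r → ℕ)) ∧
    S₂ = AddSubmonoid.closure (A₂ : Set (Fin r → ℕ)) ∧
    d ∈ S₁ ∧ d ∈ S₂ ∧ d ≠ 0 ∧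
    intSpan A₁ ⊓ intSpan A₂ = AddSubgroup.zmultiples (toInt d)

end AffineSemigroup

namespace AffineSemigroup

/-! ### Factorizations and the kernel congruence -/

variable {r : ℕ} {A B : Finset (Fin r → ℕ)} {S : AddSubmonoid (Fin r → ℕ)} {d : Fin r → ℕ}

/-! Everything reduces to one condition, `LiesAboveDegree A d`: a vector with a rival factorization
dominates a factorization of `d`. It is equivalent to Betti(S) ⊆ {d} (`betti_subset_iff`). A
presentation concentrated in degree `d` forces it; conversely, subtracting pairs of degree `d`
reduces every relation, so a generator in any other degree is redundant
(`IsMinimalPresentation.piHom_eq`). Equality with {d} adds only that some element has two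
factorizations.

Under this condition distinct factorizations of `d` have disjoint supports, since a common generator
could be cancelled. Hence pairs of them are exactly the Graver elements and exactly the circuits.
Conversely, the Graver basis is always a presentation, so the condition holds once that basis sits
in degree `d`.

For gluings, A is split along the support of one factorization of `d`, which all the others avoid.
Conversely, in a gluing the A₁-parts of equivalent vectors u and v differ in degree by n·d, and the
sign of n tells which part of u dominates a factorization of `d` (`LiesAboveDegree.of_isGluing`). -/

theorem piHom_apply (u : A → ℕ) : piHom A u = ∑ a : A, u a • (a : Fin r → ℕ) := rfl

theorem piHom_single (a : A) : piHom A (Pi.single a 1) = a := by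
  rw [piHom_apply, Finset.sum_eq_single a]
  · simp
  · intro b _ hb
    simp [hb]
  · simp

theorem kerCon_iff {u v : A → ℕ} : kerCon A u v ↔ piHom A u = piHom A v := AddCon.ker_rel _

theorem mem_closure_iff {x : Fin r → ℕ} :
    x ∈ AddSubmonoid.closure (A : Set (Fin r → ℕ)) ↔ ∃ u, piHom A u = x := by
  constructor
  · intro hx
    induction hx using AddSubmonoid.closure_induction with
    | mem x hx => exact ⟨_, piHom_single ⟨x, hx⟩⟩
    | zero => exact ⟨0, map_zero _⟩
    | add x y _ _ hx hy =>
      obtain ⟨u, rfl⟩ := hx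
      obtain ⟨v, rfl⟩ := hy
      exact ⟨u + v, map_add _ _ _⟩
  · rintro ⟨u, rfl⟩
    exact sum_mem fun a _ => nsmul_mem (AddSubmonoid.subset_closure a.2) _

theorem eq_zero_of_piHom_eq_zero (h0 : (0 : Fin r → ℕ) ∉ A) {u : A → ℕ} (hu : piHom A u = 0) :
    u = 0 := by
  funext a
  by_contra ha
  refine h0 ?_
  have h : u a • (a : Fin r → ℕ) = 0 := by
    rw [piHom_apply, Finset.sum_eq_zero_iff] at hu
    exact hu a (Finset.mem_univ a)
  have h' : (a : Fin r → ℕ) = 0 := (smul_eq_zero.mp h).resolve_left ha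
  exact h' ▸ a.2

/-- Factorizations of one element are pairwise incomparable: a difference would be a factorization
of 0. -/
theorem eq_of_le_of_piHom_eq (h0 : (0 : Fin r → ℕ) ∉ A) {u v : A → ℕ} (h : u ≤ v)
    (huv : piHom A u = piHom A v) : u = v := by
  obtain ⟨w, rfl⟩ := exists_add_of_le h
  rw [map_add, left_eq_add] at huv
  rw [eq_zero_of_piHom_eq_zero h0 huv, add_zero]

/-! ### Minimal generating sets -/

/-- In ℕ^r every summand is below the sum, so an element not above `a` cannot use `a`. -/
theorem mem_closure_erase_of_not_le {a x : Fin r → ℕ}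
    (hx : x ∈ AddSubmonoid.closure (A : Set (Fin r → ℕ))) (hax : ¬ a ≤ x) :
    x ∈ AddSubmonoid.closure ((A.erase a : Finset (Fin r → ℕ)) : Set (Fin r → ℕ)) := by
  induction hx using AddSubmonoid.closure_induction with
  | mem x hx =>
    refine AddSubmonoid.subset_closure (Finset.mem_coe.mpr (Finset.mem_erase.mpr ⟨?_, hx⟩))
    rintro rfl
    exact hax le_rfl
  | zero => exact zero_mem _
  | add x y _ _ hx hy =>
    exact add_mem (hx fun h => hax (h.trans le_self_add)) (hy fun h => hax (h.trans le_add_self))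

theorem MinimallyGenerates.notMem_closure_erase (hA : MinimallyGenerates A S) {a : Fin r → ℕ}
    (ha : a ∈ A) :
    a ∉ AddSubmonoid.closure ((A.erase a : Finset (Fin r → ℕ)) : Set (Fin r → ℕ)) := by
  intro h
  refine hA.2 _ (Finset.erase_ssubset ha) ?_
  rw [← hA.1]
  refine le_antisymm (AddSubmonoid.closure_mono (by simp)) ((AddSubmonoid.closure_le).mpr ?_)
  intro b hb
  by_cases hab : b = a
  · exact hab ▸ h
  · exact AddSubmonoid.subset_closure (by simpa [hab] using hb)

theorem MinimallyGenerates.zero_notMem (hA : MinimallyGenerates A S) : (0 : Fin r → ℕ) ∉ A :=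
  fun h => hA.notMem_closure_erase h (zero_mem _)

theorem MinimallyGenerates.of_subset (hA : MinimallyGenerates A S) (hBA : B ⊆ A) :
    MinimallyGenerates B (AddSubmonoid.closure (B : Set (Fin r → ℕ))) := by
  refine ⟨rfl, fun C hC h => ?_⟩
  obtain ⟨a, haB, haC⟩ := Finset.exists_of_ssubset hC
  refine hA.notMem_closure_erase (hBA haB) ?_
  have ha : a ∈ AddSubmonoid.closure (C : Set (Fin r → ℕ)) :=
    h ▸ AddSubmonoid.subset_closure (Finset.mem_coe.mpr haB)
  refine AddSubmonoid.closure_mono ?_ ha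
  exact Finset.coe_subset.mpr
    (Finset.subset_erase.mpr ⟨hC.subset.trans hBA, haC⟩)

theorem MinimallyGenerates.subset (hA : MinimallyGenerates A S)
    (hB : AddSubmonoid.closure (B : Set (Fin r → ℕ)) = S) : A ⊆ B := by
  intro a ha
  by_contra haB
  -- Generators of B below `a` differ from `a`, so they are not above it and can be written without
  -- it.
  have key : ∀ x ∈ AddSubmonoid.closure (B : Set (Fin r → ℕ)), x ≤ a →
      x ∈ AddSubmonoid.closure ((A.erase a : Finset (Fin r → ℕ)) : Set (Fin r → ℕ)) := by
    intro x hx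
    induction hx using AddSubmonoid.closure_induction with
    | mem x hx =>
      intro hxa
      refine mem_closure_erase_of_not_le ?_ fun h => ?_
      · rw [hA.1, ← hB]
        exact AddSubmonoid.subset_closure hx
      · exact haB (le_antisymm hxa h ▸ hx)
    | zero => exact fun _ => zero_mem _
    | add x y _ _ hx hy =>
      exact fun h => add_mem (hx (le_self_add.trans h)) (hy (le_add_self.trans h))
  refine hA.notMem_closure_erase ha (key a ?_ le_rfl)
  rw [hB, ← hA.1]
  exact AddSubmonoid.subset_closure ha

theorem MinimallyGenerates.unique (hA : MinimallyGenerates A S) (hB : MinimallyGenerates B S) :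
    A = B :=
  (hA.subset hB.1).antisymm (hB.subset hA.1)

theorem MinimallyGenerates.mem_betti_iff (hA : MinimallyGenerates A S) {b : Fin r → ℕ} :
    b ∈ betti S ↔ ∃ σ, IsMinimalPresentation A σ ∧ ∃ q ∈ σ, piHom A q.1 = b := by
  constructor
  · rintro ⟨B, hB, h⟩
    obtain rfl := hA.unique hB
    exact h
  · exact fun h => ⟨A, hA, h⟩

/-! ### Existence of minimal presentations -/

theorem IsPresentation.kerCon_of_mem {σ : Set ((A → ℕ) × (A → ℕ))} (hσ : IsPresentation A σ)
    {q : (A → ℕ) × (A → ℕ)} (hq : q ∈ σ) : kerCon A q.1 q.2 := by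
  have h : addConGen (fun u v => (u, v) ∈ σ) q.1 q.2 := AddConGen.Rel.of _ _ hq
  rwa [show addConGen (fun u v => (u, v) ∈ σ) = kerCon A from hσ] at h

theorem IsPresentation.kerCon_le {σ : Set ((A → ℕ) × (A → ℕ))} (hσ : IsPresentation A σ)
    {c : AddCon (A → ℕ)} (hc : ∀ q ∈ σ, c q.1 q.2) : kerCon A ≤ c := by
  rw [← show addConGen (fun u v => (u, v) ∈ σ) = kerCon A from hσ]
  exact AddCon.addConGen_le.mpr fun u v h => hc (u, v) h

/-- Dickson's lemma: antichains in ℕ^A × ℕ^A are finite. -/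
theorem irreducibles_finite : (irreducibles A).Finite :=
  WellQuasiOrderedLE.finite_of_isAntichain (setOfPred_minimal_antichain _)

theorem exists_irreducible_le {u v : A → ℕ} (huv : piHom A u = piHom A v)
    (hne : ((u, v) : (A → ℕ) × (A → ℕ)) ≠ 0) : ∃ q ∈ irreducibles A, q ≤ (u, v) := by
  obtain ⟨q, hq, hm⟩ := exists_minimal_le_of_wellFoundedLT
    (fun q : (A → ℕ) × (A → ℕ) => kerCon A q.1 q.2 ∧ q ≠ 0) (u, v) ⟨kerCon_iff.mpr huv, hne⟩
  exact ⟨q, hm, hq⟩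

/-- Subtracting an irreducible pair leaves a smaller relation, by cancellation in ℕ^r. The excluded
pairs (e_a, e_a) hold by reflexivity. -/
theorem graver_isPresentation (A : Finset (Fin r → ℕ)) : IsPresentation A (graver A) := by
  refine le_antisymm ?_ ?_
  · exact AddCon.addConGen_le.mpr fun u v h => h.1.1.1
  intro u v huv
  generalize hq : ((u, v) : (A → ℕ) × (A → ℕ)) = q
  induction q using WellFoundedLT.induction generalizing u v with
  | ind q ih =>
  subst hq
  by_cases hne : ((u, v) : (A → ℕ) × (A → ℕ)) = 0
  · obtain ⟨rfl, rfl⟩ := Prod.mk.inj hne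
    exact AddCon.refl _ _
  obtain ⟨⟨x, y⟩, hm, hle⟩ := exists_irreducible_le (kerCon_iff.mp huv) hne
  obtain ⟨u', rfl⟩ := exists_add_of_le (Prod.mk_le_mk.mp hle).1
  obtain ⟨v', rfl⟩ := exists_add_of_le (Prod.mk_le_mk.mp hle).2
  have hxy := kerCon_iff.mp hm.1.1
  have h' : piHom A u' = piHom A v' := by
    have := kerCon_iff.mp huv
    rwa [map_add, map_add, hxy, add_right_inj] at this
  refine AddCon.add _ ?_ ?_
  · by_cases hd : (x, y) ∈ graver A
    · exact AddConGen.Rel.of _ _ hd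
    · obtain ⟨a, ha⟩ : (x, y) ∈ Set.range
          (fun a : A => ((Pi.single a 1, Pi.single a 1) : (A → ℕ) × (A → ℕ))) := by
        by_contra h
        exact hd ⟨hm, h⟩
      obtain ⟨rfl, rfl⟩ := Prod.mk.inj ha
      exact AddCon.refl _ _
  · refine ih (u', v') (lt_of_le_of_ne ⟨le_add_self, le_add_self⟩ ?_) (kerCon_iff.mpr h') rfl
    intro h
    obtain ⟨h1, h2⟩ := Prod.mk.inj h
    rw [right_eq_add] at h1 h2
    exact hm.1.2 (by simp [h1, h2])

/-- Finiteness of the Graver basis provides an inclusion-minimal presentation among its subsets. -/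
theorem exists_isMinimalPresentation (A : Finset (Fin r → ℕ)) :
    ∃ σ, IsMinimalPresentation A σ := by
  have hfin : (graver A).Finite := irreducibles_finite.subset Set.sdiff_subset
  obtain ⟨σ, hσ, hm⟩ := (hfin.finite_subsets.subset
    (fun σ hσ => hσ.1 : {σ | σ ⊆ graver A ∧ IsPresentation A σ} ⊆ _)).exists_minimal
    ⟨_, subset_rfl, graver_isPresentation A⟩
  exact ⟨σ, hσ.2, fun τ hτ h => hτ.2 (hm ⟨hτ.1.trans hσ.1, h⟩ hτ.1)⟩

/-! ### Congruences generated in a single degree -/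

/-- Each factorization of an element with several factorizations lies above a factorization
of `d`. -/
def LiesAboveDegree (A : Finset (Fin r → ℕ)) (d : Fin r → ℕ) : Prop :=
  ∀ u v : A → ℕ, piHom A u = piHom A v → u ≠ v → ∃ z, piHom A z = d ∧ z ≤ u

/-- The congruence relating the elements lying above a factorization of `d`. -/
def aboveCon (A : Finset (Fin r → ℕ)) (d : Fin r → ℕ) : AddCon (A → ℕ) where
  r u v := u = v ∨ (∃ z, piHom A z = d ∧ z ≤ u) ∧ ∃ z, piHom A z = d ∧ z ≤ v
  iseqv :=
    { refl := fun _ => Or.inl rfl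
      symm := fun h => h.elim (fun h => Or.inl h.symm) fun h => Or.inr h.symm
      trans := by
        rintro u v w (rfl | h) (rfl | h')
        · exact Or.inl rfl
        · exact Or.inr h'
        · exact Or.inr h
        · exact Or.inr ⟨h.1, h'.2⟩ }
  add' := by
    have key : ∀ {u w : A → ℕ}, (∃ z, piHom A z = d ∧ z ≤ u) → u ≤ w →
        ∃ z, piHom A z = d ∧ z ≤ w := fun ⟨z, hz, hzu⟩ h => ⟨z, hz, hzu.trans h⟩
    rintro u v u' v' (rfl | h) (rfl | h')
    · exact Or.inl rfl
    · exact Or.inr ⟨key h'.1 le_add_self, key h'.2 le_add_self⟩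
    · exact Or.inr ⟨key h.1 le_self_add, key h.2 le_self_add⟩
    · exact Or.inr ⟨key h.1 le_self_add, key h.2 le_self_add⟩

theorem IsPresentation.liesAboveDegree {σ : Set ((A → ℕ) × (A → ℕ))} (hσ : IsPresentation A σ)
    (hd : ∀ q ∈ σ, piHom A q.1 = d) : LiesAboveDegree A d := by
  intro u v huv hne
  have h : aboveCon A d u v := hσ.kerCon_le (fun q hq => Or.inr
    ⟨⟨_, hd q hq, le_rfl⟩, ⟨_, (kerCon_iff.mp (hσ.kerCon_of_mem hq)).symm.trans (hd q hq), le_rfl⟩⟩)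
    (kerCon_iff.mpr huv)
  exact (h.resolve_left hne).1

theorem LiesAboveDegree.exists_pair (h : LiesAboveDegree A d) {u v : A → ℕ}
    (huv : piHom A u = piHom A v) (hne : u ≠ v) :
    ∃ z z' : A → ℕ, piHom A z = d ∧ piHom A z' = d ∧ z ≤ u ∧ z' ≤ v := by
  obtain ⟨z, hz, hzu⟩ := h u v huv hne
  obtain ⟨z', hz', hzv⟩ := h v u huv.symm hne.symm
  exact ⟨z, z', hz, hz', hzu, hzv⟩

/-- Peeling a factorization of `d` off each side gives a strictly smaller relation, because `d ≠ 0`.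
-/
theorem LiesAboveDegree.kerCon_le (h : LiesAboveDegree A d) (hd : d ≠ 0) {c : AddCon (A → ℕ)}
    (hc : ∀ z z', piHom A z = d → piHom A z' = d → c z z') : kerCon A ≤ c := by
  intro u v huv
  induction u using WellFoundedLT.induction generalizing v with
  | ind u ih =>
  by_cases hne : u = v
  · exact hne ▸ AddCon.refl _ _
  have huv' := kerCon_iff.mp huv
  obtain ⟨z, z', hz, hz', hzu, hzv⟩ := h.exists_pair huv' hne
  obtain ⟨u', rfl⟩ := exists_add_of_le hzu
  obtain ⟨v', rfl⟩ := exists_add_of_le hzv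
  refine AddCon.add _ (hc z z' hz hz') (ih u' (lt_of_le_of_ne le_add_self ?_) (kerCon_iff.mpr ?_))
  · rintro h
    rw [right_eq_add] at h
    exact hd (by rw [← hz, h, map_zero])
  · rwa [map_add, map_add, hz, hz', add_right_inj] at huv'

/-- The congruence obtained from `c` by also relating all `u`, `v` with equal images above `b`. -/
def aboveDegreeCon (A : Finset (Fin r → ℕ)) (b : Fin r → ℕ) (c : AddCon (A → ℕ)) :
    AddCon (A → ℕ) where
  r u v := piHom A u = piHom A v ∧ (b ≤ piHom A u ∨ c u v)
  iseqv :=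
    { refl := fun u => ⟨rfl, Or.inr (c.refl u)⟩
      symm := fun ⟨h, h'⟩ => ⟨h.symm, h'.imp (fun h' => h ▸ h') c.symm⟩
      trans := by
        rintro u v w ⟨h, hb | hc⟩ ⟨h', hb' | hc'⟩
        · exact ⟨h.trans h', Or.inl hb⟩
        · exact ⟨h.trans h', Or.inl hb⟩
        · exact ⟨h.trans h', Or.inl (h ▸ hb')⟩
        · exact ⟨h.trans h', Or.inr (c.trans hc hc')⟩ }
  add' := by
    rintro u v u' v' ⟨h, h1⟩ ⟨h', h1'⟩
    refine ⟨by rw [map_add, map_add, h, h'], ?_⟩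
    rw [map_add]
    rcases h1 with hb | hc
    · exact Or.inl (hb.trans le_self_add)
    rcases h1' with hb' | hc'
    · exact Or.inl (hb'.trans le_add_self)
    · exact Or.inr (c.add hc hc')

/-- A pair q of degree b ≠ d splits as (z, z') + (u, v) of degrees d and b - d. Neither degree is
above b, so neither relation needs q, and q is redundant. -/
theorem IsMinimalPresentation.piHom_eq {σ : Set ((A → ℕ) × (A → ℕ))}
    (hσ : IsMinimalPresentation A σ) (h : LiesAboveDegree A d) (hd : d ≠ 0)
    {q : (A → ℕ) × (A → ℕ)} (hq : q ∈ σ) : piHom A q.1 = d := by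
  by_contra hqd
  set c := addConGen (fun u v : A → ℕ => (u, v) ∈ σ \ {q}) with hcdef
  have hqker := hσ.1.kerCon_of_mem hq
  -- Relations in degrees not above that of q never use q; `aboveDegreeCon` makes this precise.
  have hlow : ∀ {u v : A → ℕ}, piHom A u = piHom A v → ¬ piHom A q.1 ≤ piHom A u → c u v := by
    intro u v huv hn
    have hle : kerCon A ≤ aboveDegreeCon A (piHom A q.1) c := by
      refine hσ.1.kerCon_le fun p hp => ⟨kerCon_iff.mp (hσ.1.kerCon_of_mem hp), ?_⟩
      by_cases hpq : p = q
      · exact Or.inl (hpq ▸ le_rfl)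
      · exact Or.inr (AddConGen.Rel.of _ _ ⟨hp, hpq⟩)
    exact (hle (kerCon_iff.mpr huv)).2.resolve_left hn
  have hcq : c q.1 q.2 := by
    by_cases hne : q.1 = q.2
    · rw [← hne]
      exact c.refl _
    have hq' := kerCon_iff.mp hqker
    obtain ⟨z, z', hz, hz', hzu, hzv⟩ := h.exists_pair hq' hne
    obtain ⟨u, hu⟩ := exists_add_of_le hzu
    obtain ⟨v, hv⟩ := exists_add_of_le hzv
    have huq : piHom A q.1 = d + piHom A u := by rw [hu, map_add, hz]
    have hvq : piHom A q.1 = d + piHom A v := by rw [hq', hv, map_add, hz']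
    rw [hu, hv]
    refine c.add (hlow (hz.trans hz'.symm) fun hle => hqd ?_)
      (hlow (add_left_cancel (huq.symm.trans hvq)) fun hle => hd ?_)
    · exact le_antisymm (hz ▸ hle) (huq ▸ le_self_add)
    · rw [huq] at hle
      have := le_antisymm hle le_add_self
      exact add_eq_right.mp this
  refine hσ.2 (σ \ {q}) ⟨Set.sdiff_subset, fun hsub => (hsub hq).2 rfl⟩ (le_antisymm ?_ ?_)
  · exact AddCon.addConGen_le.mpr fun u v huv => hσ.1.kerCon_of_mem huv.1
  · refine hσ.1.kerCon_le fun p hp => ?_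
    by_cases hpq : p = q
    · subst hpq
      exact hcq
    · exact AddConGen.Rel.of _ _ ⟨hp, hpq⟩

/-! ### Betti elements in terms of `LiesAboveDegree` -/

theorem MinimallyGenerates.betti_subset_iff (hA : MinimallyGenerates A S) (hd : d ≠ 0) :
    betti S ⊆ {d} ↔ LiesAboveDegree A d := by
  constructor
  · intro h
    obtain ⟨σ, hσ⟩ := exists_isMinimalPresentation A
    exact hσ.1.liesAboveDegree fun q hq => h (hA.mem_betti_iff.mpr ⟨σ, hσ, q, hq, rfl⟩)
  · intro h b hb
    obtain ⟨σ, hσ, q, hq, rfl⟩ := hA.mem_betti_iff.mp hb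
    exact hσ.piHom_eq h hd hq

theorem MinimallyGenerates.betti_nonempty_iff (hA : MinimallyGenerates A S) :
    (betti S).Nonempty ↔ ∃ u v : A → ℕ, piHom A u = piHom A v ∧ u ≠ v := by
  constructor
  · rintro ⟨b, hb⟩
    obtain ⟨σ, hσ, q, hq, -⟩ := hA.mem_betti_iff.mp hb
    by_contra! hinj
    refine hσ.2 ∅ (Set.empty_ssubset.mpr ⟨q, hq⟩) (le_antisymm ?_ ?_)
    · exact AddCon.addConGen_le.mpr fun u v huv => huv.elim
    · intro u v huv
      rw [hinj u v (kerCon_iff.mp huv)]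
      exact AddCon.refl _ _
  · rintro ⟨u, v, huv, hne⟩
    obtain ⟨σ, hσ⟩ := exists_isMinimalPresentation A
    obtain ⟨q, hq⟩ : σ.Nonempty := by
      by_contra! hemp
      subst hemp
      exact hne (hσ.1.kerCon_le (c := ⊥) (fun q hq => hq.elim) (kerCon_iff.mpr huv))
    exact ⟨_, hA.mem_betti_iff.mpr ⟨σ, hσ, q, hq, rfl⟩⟩

theorem MinimallyGenerates.betti_eq_singleton_iff (hA : MinimallyGenerates A S) (hd : d ≠ 0) :
    betti S = {d} ↔ LiesAboveDegree A d ∧ ∃ u v : A → ℕ, piHom A u = piHom A v ∧ u ≠ v := by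
  rw [← hA.betti_subset_iff hd, ← hA.betti_nonempty_iff, and_comm]
  exact Set.eq_singleton_iff_nonempty_unique_mem

/-! ### Circuits and the Graver basis of a semigroup with one Betti element -/

theorem mem_distinctFactorizationPairs_iff {u v : A → ℕ} :
    (u, v) ∈ distinctFactorizationPairs A d ↔ piHom A u = d ∧ piHom A v = d ∧ u ≠ v := by
  constructor
  · rintro ⟨⟨hu, hv⟩, hne⟩
    refine ⟨hu, hv, ?_⟩
    rintro rfl
    exact hne ⟨u, hu, rfl⟩
  · rintro ⟨hu, hv, hne⟩
    refine ⟨⟨hu, hv⟩, ?_⟩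
    rintro ⟨w, -, h⟩
    obtain ⟨rfl, rfl⟩ := Prod.mk.inj h
    exact hne rfl

theorem ne_zero_of_piHom_eq (hd : d ≠ 0) {z : A → ℕ} (hz : piHom A z = d) : z ≠ 0 := by
  rintro rfl
  exact hd (by rw [← hz, map_zero])

theorem support_subset_of_le {u v : A → ℕ} (h : u ≤ v) :
    Function.support u ⊆ Function.support v := by
  intro a ha hv
  exact ha (Nat.eq_zero_of_le_zero (hv ▸ h a))

theorem IsDisjointRelation.ne {u v : A → ℕ} (h : IsDisjointRelation A (u, v)) : u ≠ v := by
  rintro rfl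
  have h1 : u = 0 := Function.support_eq_empty_iff.mp (disjoint_self.mp h.2.2)
  exact h.2.1 (by rw [h1]; rfl)

/-- After cancelling a common generator, the remainder of z still dominates a factorization of `d`,
which lies strictly below z. This contradicts incomparability. -/
theorem LiesAboveDegree.disjoint_support (h : LiesAboveDegree A d) (h0 : (0 : Fin r → ℕ) ∉ A)
    {z z' : A → ℕ} (hz : piHom A z = d) (hz' : piHom A z' = d) (hne : z ≠ z') :
    Disjoint (Function.support z) (Function.support z') := by
  rw [Set.disjoint_left]
  intro a ha ha'
  have hle : ∀ {w : A → ℕ}, a ∈ Function.support w → Pi.single a 1 ≤ w := by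
    intro w hw b
    rcases eq_or_ne b a with rfl | hb
    · simpa using Nat.one_le_iff_ne_zero.mpr hw
    · simp [hb]
  obtain ⟨u, rfl⟩ := exists_add_of_le (hle ha)
  obtain ⟨v, rfl⟩ := exists_add_of_le (hle ha')
  have huv : piHom A u = piHom A v := by
    rwa [← hz', map_add, map_add, add_right_inj] at hz
  obtain ⟨w, hw, hwu⟩ := h u v huv fun h => hne (by rw [h])
  have h1 := eq_of_le_of_piHom_eq h0 (hwu.trans le_add_self) (hw.trans hz.symm)
  have h2 : w a ≤ u a := hwu a
  rw [h1] at h2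
  simp at h2

theorem LiesAboveDegree.eq_of_support (h : LiesAboveDegree A d) (h0 : (0 : Fin r → ℕ) ∉ A)
    (hd : d ≠ 0) {z z' : A → ℕ} (hz : piHom A z = d) (hz' : piHom A z' = d)
    (hs : Function.support z ⊆ Function.support z') : z = z' := by
  by_contra hne
  have := (h.disjoint_support h0 hz hz' hne).mono_right hs
  exact ne_zero_of_piHom_eq hd hz (Function.support_eq_empty_iff.mp (disjoint_self.mp this))

/-- A relation x ≠ y contains a pair of factorizations of `d`, and incomparability turns domination
into equality. A relation x = y below a pair with disjoint supports is zero. -/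
theorem LiesAboveDegree.distinctFactorizationPairs_eq_graver (h : LiesAboveDegree A d)
    (h0 : (0 : Fin r → ℕ) ∉ A) (hd : d ≠ 0) :
    distinctFactorizationPairs A d = graver A := by
  ext ⟨u, v⟩
  rw [mem_distinctFactorizationPairs_iff]
  constructor
  · rintro ⟨hu, hv, hne⟩
    refine ⟨⟨⟨kerCon_iff.mpr (hu.trans hv.symm), ?_⟩, ?_⟩, ?_⟩
    · intro h
      exact ne_zero_of_piHom_eq hd hu (Prod.mk.inj h).1
    · rintro ⟨x, y⟩ ⟨hxy, hne'⟩ ⟨hxu, hyv⟩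
      rw [kerCon_iff] at hxy
      simp only at hxu hyv hxy
      by_cases hxy' : x = y
      · subst hxy'
        refine absurd ?_ hne'
        have := (h.disjoint_support h0 hu hv hne).mono (support_subset_of_le hxu)
          (support_subset_of_le hyv)
        rw [Function.support_eq_empty_iff.mp (disjoint_self.mp this)]
        rfl
      · obtain ⟨z, z', hz, hz', hzx, hzy⟩ := h.exists_pair hxy hxy'
        have h1 := eq_of_le_of_piHom_eq h0 (hzx.trans hxu) (hz.trans hu.symm)
        have h2 := eq_of_le_of_piHom_eq h0 (hzy.trans hyv) (hz'.trans hv.symm)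
        exact ⟨h1 ▸ hzx, h2 ▸ hzy⟩
    · rintro ⟨a, ha⟩
      obtain ⟨rfl, rfl⟩ := Prod.mk.inj ha
      exact hne rfl
  · rintro ⟨hm, hr⟩
    have huv := kerCon_iff.mp hm.1.1
    have hne : u ≠ v := by
      rintro rfl
      obtain ⟨a, ha⟩ : ∃ a, u a ≠ 0 := by
        by_contra! hu
        exact hm.1.2 (by rw [show u = 0 from funext hu]; rfl)
      have hle : (Pi.single a 1 : A → ℕ) ≤ u := by
        intro b
        rcases eq_or_ne b a with rfl | hb
        · simpa using Nat.one_le_iff_ne_zero.mpr ha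
        · simp [hb]
      refine hr ⟨a, ?_⟩
      have hle' : ((Pi.single a 1, Pi.single a 1) : (A → ℕ) × (A → ℕ)) ≤ (u, u) := ⟨hle, hle⟩
      refine le_antisymm hle' (hm.2 ⟨AddCon.refl _ _, fun h => ?_⟩ hle')
      simpa using congrFun (Prod.mk.inj h).1 a
    obtain ⟨z, z', hz, hz', hzu, hzv⟩ := h.exists_pair huv hne
    have hle := hm.2 (y := (z, z')) ⟨kerCon_iff.mpr (hz.trans hz'.symm),
      fun h => ne_zero_of_piHom_eq hd hz (Prod.mk.inj h).1⟩ ⟨hzu, hzv⟩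
    obtain rfl : u = z := le_antisymm hle.1 hzu
    obtain rfl : v = z' := le_antisymm hle.2 hzv
    exact ⟨hz, hz', hne⟩

/-- Only z is a factorization of `d` supported in supp z, and likewise for z', so the pair peeled
off is always (z, z'). -/
theorem LiesAboveDegree.exists_smul (h : LiesAboveDegree A d) (h0 : (0 : Fin r → ℕ) ∉ A)
    (hd : d ≠ 0) {z z' : A → ℕ} (hz : piHom A z = d) (hz' : piHom A z' = d) (hne : z ≠ z')
    {u v : A → ℕ} (huv : piHom A u = piHom A v) (hu : Function.support u ⊆ Function.support z)
    (hv : Function.support v ⊆ Function.support z') : ∃ k : ℕ, u = k • z ∧ v = k • z' := by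
  induction u using WellFoundedLT.induction generalizing v with
  | ind u ih =>
  by_cases huv' : u = v
  · subst huv'
    have := (h.disjoint_support h0 hz hz' hne).mono hu hv
    rw [Function.support_eq_empty_iff.mp (disjoint_self.mp this)]
    exact ⟨0, by simp, by simp⟩
  obtain ⟨w, w', hw, hw', hwu, hwv⟩ := h.exists_pair huv huv'
  obtain rfl := h.eq_of_support h0 hd hw hz ((support_subset_of_le hwu).trans hu)
  obtain rfl := h.eq_of_support h0 hd hw' hz' ((support_subset_of_le hwv).trans hv)
  obtain ⟨x, rfl⟩ := exists_add_of_le hwu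
  obtain ⟨y, rfl⟩ := exists_add_of_le hwv
  obtain ⟨k, rfl, rfl⟩ := ih x (lt_of_le_of_ne le_add_self fun h =>
      ne_zero_of_piHom_eq hd hw (right_eq_add.mp h))
    (by rwa [map_add, map_add, hw, hw', add_right_inj] at huv)
    ((support_subset_of_le le_add_self).trans hu) ((support_subset_of_le le_add_self).trans hv)
  exact ⟨k + 1, by rw [succ_nsmul'], by rw [succ_nsmul']⟩

theorem LiesAboveDegree.circuits_eq (h : LiesAboveDegree A d) (h0 : (0 : Fin r → ℕ) ∉ A)
    (hd : d ≠ 0) : circuits A = distinctFactorizationPairs A d := by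
  ext ⟨u, v⟩
  rw [mem_distinctFactorizationPairs_iff]
  constructor
  · rintro ⟨hrel, hmin, hgcd⟩
    have huv := kerCon_iff.mp hrel.1
    have hdisj := hrel.2.2
    simp only at hmin hgcd huv hdisj
    obtain ⟨z, z', hz, hz', hzu, hzv⟩ := h.exists_pair huv hrel.ne
    have hzs := support_subset_of_le hzu
    have hzs' := support_subset_of_le hzv
    have hdisj' := hdisj.mono hzs hzs'
    have hne : z ≠ z' := by
      rintro rfl
      exact ne_zero_of_piHom_eq hd hz
        (Function.support_eq_empty_iff.mp (disjoint_self.mp hdisj'))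
    -- Minimality of the circuit's support forces it to be that of (z, z'); the gcd condition then
    -- makes the multiple k equal to 1.
    have hsub : Function.support u ∪ Function.support v ⊆
        Function.support z ∪ Function.support z' := by
      by_contra hn
      exact hmin (z, z') ⟨kerCon_iff.mpr (hz.trans hz'.symm),
        fun h => ne_zero_of_piHom_eq hd hz (Prod.mk.inj h).1, hdisj'⟩
        ⟨Set.union_subset_union hzs hzs', hn⟩
    obtain ⟨k, rfl, rfl⟩ := h.exists_smul h0 hd hz hz' hne huv
      (fun a ha => (hsub (Or.inl ha)).resolve_right fun h =>
        Set.disjoint_left.mp hdisj ha (hzs' h))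
      (fun a ha => (hsub (Or.inr ha)).resolve_left fun h =>
        Set.disjoint_left.mp hdisj (hzs h) ha)
    have hk : k = 1 := by
      rw [← Nat.dvd_one, ← hgcd]
      exact Nat.dvd_gcd (Finset.dvd_gcd fun a _ => ⟨z a, rfl⟩)
        (Finset.dvd_gcd fun a _ => ⟨z' a, rfl⟩)
    subst hk
    rw [one_smul, one_smul]
    exact ⟨hz, hz', hne⟩
  · rintro ⟨hu, hv, hne⟩
    have hdisj := h.disjoint_support h0 hu hv hne
    have hu0 := ne_zero_of_piHom_eq hd hu
    refine ⟨⟨kerCon_iff.mpr (hu.trans hv.symm), fun h => hu0 (Prod.mk.inj h).1, hdisj⟩, ?_, ?_⟩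
    · rintro ⟨x, y⟩ hrel ⟨hsub, hnsub⟩
      have hdisj' := hrel.2.2
      simp only at hsub hnsub hdisj'
      obtain ⟨z, z', hz, hz', hzx, hzy⟩ := h.exists_pair (kerCon_iff.mp hrel.1) hrel.ne
      have hzs := support_subset_of_le hzx
      have hzs' := support_subset_of_le hzy
      -- A third factorization of `d` would have support disjoint from both u and v. Hence a smaller
      -- relation already contains both u and v.
      have key : ∀ w : A → ℕ, piHom A w = d → Function.support w ⊆
          Function.support x ∪ Function.support y → w = u ∨ w = v := by
        intro w hw hs
        by_contra! hn
        have h1 := h.disjoint_support h0 hw hu hn.1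
        have h2 := h.disjoint_support h0 hw hv hn.2
        have h3 := (h1.sup_right h2).mono_right (hs.trans hsub)
        exact ne_zero_of_piHom_eq hd hw (Function.support_eq_empty_iff.mp (disjoint_self.mp h3))
      have hne' : z ≠ z' := by
        rintro rfl
        exact ne_zero_of_piHom_eq hd hz
          (Function.support_eq_empty_iff.mp (disjoint_self.mp (hdisj'.mono hzs hzs')))
      have hsz := hzs.trans (Set.subset_union_left (t := Function.support y))
      have hsz' := hzs'.trans (Set.subset_union_right (s := Function.support x))
      rcases key z hz hsz with rfl | rfl <;> rcases key z' hz' hsz' with rfl | rfl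
      · exact hne' rfl
      · exact hnsub (Set.union_subset hsz hsz')
      · exact hnsub (Set.union_subset hsz' hsz)
      · exact hne' rfl
    · simp only
      set g := Nat.gcd (Finset.univ.gcd u) (Finset.univ.gcd v) with hg
      have hgu : ∀ a, g ∣ u a := fun a =>
        (Nat.gcd_dvd_left _ _).trans (Finset.gcd_dvd (Finset.mem_univ a))
      have hgv : ∀ a, g ∣ v a := fun a =>
        (Nat.gcd_dvd_right _ _).trans (Finset.gcd_dvd (Finset.mem_univ a))
      choose x hx using hgu
      choose y hy using hgv
      have hxu : u = g • x := funext hx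
      have hyv : v = g • y := funext hy
      have hg0 : g ≠ 0 := by
        intro hg0
        exact hu0 (by rw [hxu, hg0, zero_smul])
      have hxy : piHom A x = piHom A y := by
        have h1 := hu.trans hv.symm
        rw [hxu, hyv, map_nsmul, map_nsmul] at h1
        exact smul_right_injective _ hg0 h1
      -- The quotient x by the gcd dominates a factorization of `d` while lying below u, so x = u
      -- and the gcd is 1.
      obtain ⟨z, hz, hzx⟩ := h x y hxy fun h => hne (by rw [hxu, hyv, h])
      have hxle : x ≤ u := fun a => by
        rw [hx a]
        exact Nat.le_mul_of_pos_left _ (Nat.pos_of_ne_zero hg0)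
      have hzu := eq_of_le_of_piHom_eq h0 (hzx.trans hxle) (hz.trans hu.symm)
      obtain rfl : x = u := le_antisymm hxle (hzu ▸ hzx)
      obtain ⟨a, ha⟩ := Function.ne_iff.mp hu0
      exact Nat.eq_of_mul_eq_mul_right (Nat.pos_of_ne_zero ha) (by rw [one_mul]; exact (hx a).symm)

theorem liesAboveDegree_of_distinctFactorizationPairs_eq_graver
    (h : distinctFactorizationPairs A d = graver A) : LiesAboveDegree A d :=
  (graver_isPresentation A).liesAboveDegree fun q hq => by
    rw [← h] at hq
    exact hq.1.1

/-! ### Gluings -/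

/-- Extension by zero of a function on `B` to `A`. -/
def extend (A : Finset (Fin r → ℕ)) {B : Finset (Fin r → ℕ)} (u : B → ℕ) : A → ℕ :=
  fun a => if h : (a : Fin r → ℕ) ∈ B then u ⟨a, h⟩ else 0

/-- Restriction to `B` of a function on `A`. -/
def restrict (hBA : B ⊆ A) : (A → ℕ) →+ (B → ℕ) where
  toFun u b := u ⟨b, hBA b.2⟩
  map_zero' := rfl
  map_add' _ _ := rfl

theorem restrict_apply (hBA : B ⊆ A) (u : A → ℕ) (b : B) : restrict hBA u b = u ⟨b, hBA b.2⟩ := rfl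

theorem restrict_extend (hBA : B ⊆ A) (u : B → ℕ) : restrict hBA (extend A u) = u := by
  funext b
  rw [restrict_apply, extend, dif_pos b.2]

theorem piHom_extend (hBA : B ⊆ A) (u : B → ℕ) : piHom A (extend A u) = piHom B u := by
  symm
  refine Fintype.sum_of_injective (fun b : B => (⟨b, hBA b.2⟩ : A))
    (fun b c h => Subtype.ext (Subtype.mk.inj h)) _ _ ?_ ?_
  · intro a ha
    rw [extend, dif_neg, zero_smul]
    exact fun h => ha ⟨⟨a, h⟩, rfl⟩
  · intro b
    rw [extend, dif_pos b.2]

theorem extend_restrict_of_le (hBA : B ⊆ A) {u : B → ℕ} {z : A → ℕ} (h : z ≤ extend A u) :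
    extend A (restrict hBA z) = z := by
  funext a
  by_cases ha : (a : Fin r → ℕ) ∈ B
  · rw [extend, dif_pos ha]
    rfl
  · rw [extend, dif_neg ha]
    have := h a
    rw [extend, dif_neg ha] at this
    exact (Nat.eq_zero_of_le_zero this).symm

theorem extend_le_of_le_restrict (hBA : B ⊆ A) {u : A → ℕ} {z : B → ℕ} (h : z ≤ restrict hBA u) :
    extend A z ≤ u := by
  intro a
  by_cases ha : (a : Fin r → ℕ) ∈ B
  · rw [extend, dif_pos ha]
    exact h ⟨a, ha⟩
  · rw [extend, dif_neg ha]
    exact Nat.zero_le _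

/-- A vector below an extension by zero is itself such an extension. -/
theorem LiesAboveDegree.of_subset (h : LiesAboveDegree A d) (hBA : B ⊆ A) :
    LiesAboveDegree B d := by
  intro u v huv hne
  obtain ⟨z, hz, hzu⟩ := h (extend A u) (extend A v)
    (by rw [piHom_extend hBA, piHom_extend hBA, huv])
    fun h => hne (by rw [← restrict_extend hBA u, h, restrict_extend])
  refine ⟨restrict hBA z, ?_, ?_⟩
  · rw [← piHom_extend hBA, extend_restrict_of_le hBA hzu, hz]
  · intro b
    have := hzu ⟨b, hBA b.2⟩
    rwa [extend, dif_pos b.2] at this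

theorem extend_restrict_add {A₁ A₂ : Finset (Fin r → ℕ)} (h₁ : A₁ ⊆ A) (h₂ : A₂ ⊆ A)
    (hdisj : Disjoint A₁ A₂) (hunion : A₁ ∪ A₂ = A) (u : A → ℕ) :
    extend A (restrict h₁ u) + extend A (restrict h₂ u) = u := by
  funext a
  rw [Pi.add_apply, extend, extend]
  have ha : (a : Fin r → ℕ) ∈ A₁ ∪ A₂ := by
    rw [hunion]
    exact a.2
  rcases Finset.mem_union.mp ha with ha | ha
  · rw [dif_pos ha, dif_neg (Finset.disjoint_left.mp hdisj ha)]
    rfl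
  · rw [dif_neg (Finset.disjoint_right.mp hdisj ha), dif_pos ha, zero_add]
    rfl

theorem piHom_restrict_add {A₁ A₂ : Finset (Fin r → ℕ)} (h₁ : A₁ ⊆ A) (h₂ : A₂ ⊆ A)
    (hdisj : Disjoint A₁ A₂) (hunion : A₁ ∪ A₂ = A) (u : A → ℕ) :
    piHom A₁ (restrict h₁ u) + piHom A₂ (restrict h₂ u) = piHom A u := by
  rw [← piHom_extend h₁, ← piHom_extend h₂, ← map_add, extend_restrict_add h₁ h₂ hdisj hunion]

/-! ### Integer spans and the splitting along a factorization of `d` -/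

theorem toInt_zero : toInt (0 : Fin r → ℕ) = 0 := rfl

theorem toInt_add (x y : Fin r → ℕ) : toInt (x + y) = toInt x + toInt y :=
  funext fun _ => Nat.cast_add _ _

theorem toInt_nsmul (k : ℕ) (x : Fin r → ℕ) : toInt (k • x) = k • toInt x := by
  induction k with
  | zero => simp [toInt_zero]
  | succ k ih => rw [succ_nsmul, succ_nsmul, toInt_add, ih]

theorem toInt_injective : Function.Injective (toInt (r := r)) :=
  fun _ _ h => funext fun i => Nat.cast_injective (congrFun h i)

theorem toInt_mem_intSpan {x : Fin r → ℕ}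
    (hx : x ∈ AddSubmonoid.closure (A : Set (Fin r → ℕ))) : toInt x ∈ intSpan A := by
  induction hx using AddSubmonoid.closure_induction with
  | mem x hx => exact AddSubgroup.subset_closure ⟨x, hx, rfl⟩
  | zero => exact zero_mem _
  | add x y _ _ hx hy => exact toInt_add x y ▸ add_mem hx hy

theorem exists_sub_of_mem_intSpan {x : Fin r → ℤ} (hx : x ∈ intSpan A) :
    ∃ u v, x = toInt (piHom A u) - toInt (piHom A v) := by
  induction hx using AddSubgroup.closure_induction with
  | mem x hx =>
    obtain ⟨a, ha, rfl⟩ := hx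
    exact ⟨Pi.single ⟨a, ha⟩ 1, 0, by rw [piHom_single, map_zero, toInt_zero, sub_zero]⟩
  | zero => exact ⟨0, 0, (sub_self _).symm⟩
  | add x y _ _ hx hy =>
    obtain ⟨u, v, rfl⟩ := hx
    obtain ⟨u', v', rfl⟩ := hy
    refine ⟨u + u', v + v', ?_⟩
    rw [map_add, map_add, toInt_add, toInt_add]
    abel
  | neg x _ hx =>
    obtain ⟨u, v, rfl⟩ := hx
    exact ⟨v, u, neg_sub _ _⟩

/-- The congruence relating `u` and `v` when the images of their restrictions to `B` differ by an
integer multiple of `d`. -/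
def restrictCon (hBA : B ⊆ A) (d : Fin r → ℕ) : AddCon (A → ℕ) where
  r u v := toInt (piHom B (restrict hBA u)) - toInt (piHom B (restrict hBA v)) ∈
    AddSubgroup.zmultiples (toInt d)
  iseqv :=
    { refl := fun u => by rw [sub_self]; exact zero_mem _
      symm := fun h => by rw [← neg_sub]; exact neg_mem h
      trans := fun h h' => by rw [← sub_add_sub_cancel]; exact add_mem h h' }
  add' := by
    intro u v u' v' h h'
    simp only [map_add, toInt_add]
    rw [add_sub_add_comm]
    exact add_mem h h'

/-- A₁ is the support of z. By disjointness z' uses only the other generators, so `d` lies in both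
monoids. -/
theorem LiesAboveDegree.exists_isGluing (h : LiesAboveDegree A d) (h0 : (0 : Fin r → ℕ) ∉ A)
    (hd : d ≠ 0) {z z' : A → ℕ} (hz : piHom A z = d) (hz' : piHom A z' = d) (hne : z ≠ z') :
    ∃ A₁ A₂ : Finset (Fin r → ℕ), A₁ ⊆ A ∧ A₂ ⊆ A ∧
      IsGluing A (AddSubmonoid.closure (A₁ : Set (Fin r → ℕ)))
        (AddSubmonoid.closure (A₂ : Set (Fin r → ℕ))) d := by
  classical
  set A₁ : Finset (Fin r → ℕ) := (Finset.univ.filter fun a : A => z a ≠ 0).image Subtype.val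
    with hA₁
  have memA₁ : ∀ a : A, (a : Fin r → ℕ) ∈ A₁ ↔ z a ≠ 0 := by
    intro a
    simp [hA₁]
  have h₁ : A₁ ⊆ A := by
    intro a ha
    obtain ⟨b, -, rfl⟩ := Finset.mem_image.mp ha
    exact b.2
  have h₂ : A \ A₁ ⊆ A := Finset.sdiff_subset
  have memA₂ : ∀ a : A, (a : Fin r → ℕ) ∈ A \ A₁ ↔ z a = 0 := by
    intro a
    rw [Finset.mem_sdiff, memA₁, not_not]
    exact and_iff_right a.2
  have hdisj : Disjoint A₁ (A \ A₁) := Finset.disjoint_sdiff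
  have hunion : A₁ ∪ (A \ A₁) = A := Finset.union_sdiff_of_subset h₁
  have hsum := piHom_restrict_add h₁ h₂ hdisj hunion
  have hz₂ : restrict h₂ z = 0 := funext fun b => (memA₂ ⟨b, h₂ b.2⟩).mp b.2
  have hw₁ : ∀ w, piHom A w = d → w ≠ z → restrict h₁ w = 0 := by
    intro w hw hwz
    funext b
    by_contra hb
    exact Set.disjoint_left.mp (h.disjoint_support h0 hw hz hwz) hb
      ((memA₁ ⟨b, h₁ b.2⟩).mp b.2)
  have hd₁ : piHom A₁ (restrict h₁ z) = d := by
    rw [← hz, ← hsum, hz₂, map_zero, add_zero]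
  have hd₂ : piHom (A \ A₁) (restrict h₂ z') = d := by
    rw [← hz', ← hsum, hw₁ z' hz' hne.symm, map_zero, zero_add]
  have hmem₁ := mem_closure_iff.mpr ⟨_, hd₁⟩
  have hmem₂ := mem_closure_iff.mpr ⟨_, hd₂⟩
  have hnonempty : ∀ {C : Finset (Fin r → ℕ)} (w : C → ℕ), piHom C w = d → C.Nonempty := by
    intro C w hw
    obtain ⟨a, -⟩ := Function.ne_iff.mp (ne_zero_of_piHom_eq hd hw)
    exact ⟨a, a.2⟩
  refine ⟨A₁, A \ A₁, h₁, h₂, A₁, A \ A₁, hnonempty _ hd₁, hnonempty _ hd₂, hdisj, hunion, rfl,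
    rfl, hmem₁, hmem₂, hd, le_antisymm ?_ ?_⟩
  · rintro x ⟨hx₁, hx₂⟩
    obtain ⟨u₁, v₁, hx⟩ := exists_sub_of_mem_intSpan hx₁
    obtain ⟨u₂, v₂, hx'⟩ := exists_sub_of_mem_intSpan hx₂
    -- It suffices to check pairs of degree `d`, whose members have A₁-part of degree d (for z) or 0
    -- (for all others).
    have hle : kerCon A ≤ restrictCon h₁ d := by
      have hcase : ∀ w, piHom A w = d → toInt (piHom A₁ (restrict h₁ w)) ∈
          AddSubgroup.zmultiples (toInt d) := by
        intro w hw
        by_cases hwz : w = z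
        · rw [hwz, hd₁]
          exact AddSubgroup.mem_zmultiples _
        · rw [hw₁ w hw hwz, map_zero]
          exact zero_mem _
      exact h.kerCon_le hd fun w w' hw hw' => sub_mem (hcase w hw) (hcase w' hw')
    have hzero : ∀ w : (A \ A₁ : Finset (Fin r → ℕ)) → ℕ, restrict h₁ (extend A w) = 0 := by
      intro w
      funext b
      rw [restrict_apply, extend, dif_neg (Finset.disjoint_left.mp hdisj b.2)]
      rfl
    -- Clearing signs in u₁ - v₁ = u₂ - v₂ gives a relation in ℕ^A whose A₁-parts are u₁ and v₁.
    have hker : kerCon A (extend A u₁ + extend A v₂) (extend A v₁ + extend A u₂) := by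
      rw [kerCon_iff, map_add, map_add, piHom_extend h₁, piHom_extend h₁, piHom_extend h₂,
        piHom_extend h₂]
      apply toInt_injective
      rw [toInt_add, toInt_add, add_comm (toInt (piHom A₁ v₁)), ← sub_eq_sub_iff_add_eq_add,
        ← hx, ← hx']
    have hmem : toInt (piHom A₁ (restrict h₁ (extend A u₁ + extend A v₂))) -
        toInt (piHom A₁ (restrict h₁ (extend A v₁ + extend A u₂))) ∈
          AddSubgroup.zmultiples (toInt d) := hle hker
    rwa [map_add, map_add (restrict h₁), hzero, hzero, add_zero, add_zero, restrict_extend,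
      restrict_extend, ← hx] at hmem
  · rw [AddSubgroup.zmultiples_le]
    exact ⟨toInt_mem_intSpan hmem₁, toInt_mem_intSpan hmem₂⟩

/-- The vector v + k • w is a rival factorization, unless it is u itself; then w ≤ u since k ≠ 0. -/
theorem LiesAboveDegree.exists_le_of_piHom_eq_add (h : LiesAboveDegree A d) {u v w : A → ℕ}
    (hw : piHom A w = d) {k : ℕ} (hk : k ≠ 0) (huv : piHom A u = piHom A v + k • d) :
    ∃ z, piHom A z = d ∧ z ≤ u := by
  by_cases hu : u = v + k • w
  · obtain ⟨k, rfl⟩ := Nat.exists_eq_succ_of_ne_zero hk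
    refine ⟨w, hw, ?_⟩
    rw [hu, succ_nsmul]
    exact le_add_self.trans le_add_self
  · exact h u (v + k • w) (by rw [huv, map_add, map_nsmul, hw]) hu

theorem LiesAboveDegree.of_isGluing {A₁ A₂ : Finset (Fin r → ℕ)} (hdisj : Disjoint A₁ A₂)
    (hunion : A₁ ∪ A₂ = A) (hd₁ : d ∈ AddSubmonoid.closure (A₁ : Set (Fin r → ℕ)))
    (hd₂ : d ∈ AddSubmonoid.closure (A₂ : Set (Fin r → ℕ)))
    (hspan : intSpan A₁ ⊓ intSpan A₂ = AddSubgroup.zmultiples (toInt d))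
    (H₁ : LiesAboveDegree A₁ d) (H₂ : LiesAboveDegree A₂ d) : LiesAboveDegree A d := by
  have h₁ : A₁ ⊆ A := hunion ▸ Finset.subset_union_left
  have h₂ : A₂ ⊆ A := hunion ▸ Finset.subset_union_right
  obtain ⟨w₁, hw₁⟩ := mem_closure_iff.mp hd₁
  obtain ⟨w₂, hw₂⟩ := mem_closure_iff.mp hd₂
  intro u v huv hne
  have lift₁ : (∃ z, piHom A₁ z = d ∧ z ≤ restrict h₁ u) → ∃ z, piHom A z = d ∧ z ≤ u :=
    fun ⟨z, hz, hzu⟩ => ⟨extend A z, by rw [piHom_extend h₁, hz], extend_le_of_le_restrict h₁ hzu⟩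
  have lift₂ : (∃ z, piHom A₂ z = d ∧ z ≤ restrict h₂ u) → ∃ z, piHom A z = d ∧ z ≤ u :=
    fun ⟨z, hz, hzu⟩ => ⟨extend A z, by rw [piHom_extend h₂, hz], extend_le_of_le_restrict h₂ hzu⟩
  have hsum : toInt (piHom A₁ (restrict h₁ u)) + toInt (piHom A₂ (restrict h₂ u)) =
      toInt (piHom A₁ (restrict h₁ v)) + toInt (piHom A₂ (restrict h₂ v)) := by
    rw [← toInt_add, ← toInt_add, piHom_restrict_add h₁ h₂ hdisj hunion,
      piHom_restrict_add h₁ h₂ hdisj hunion, huv]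
  set x := toInt (piHom A₁ (restrict h₁ u)) - toInt (piHom A₁ (restrict h₁ v)) with hx
  have hx' : x = toInt (piHom A₂ (restrict h₂ v)) - toInt (piHom A₂ (restrict h₂ u)) := by
    rw [hx, sub_eq_sub_iff_add_eq_add, hsum, add_comm]
  have hxmem : x ∈ AddSubgroup.zmultiples (toInt d) := by
    rw [← hspan]
    refine AddSubgroup.mem_inf.mpr ⟨hx ▸ sub_mem ?_ ?_, hx' ▸ sub_mem ?_ ?_⟩ <;>
    exact toInt_mem_intSpan (mem_closure_iff.mpr ⟨_, rfl⟩)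
  obtain ⟨n, hn⟩ := AddSubgroup.mem_zmultiples_iff.mp hxmem
  have toNat : ∀ {p q : Fin r → ℕ} {k : ℕ}, toInt p - toInt q = k • toInt d → p = q + k • d := by
    intro p q k hpq
    apply toInt_injective
    rw [toInt_add, toInt_nsmul, ← hpq, add_sub_cancel]
  -- For n > 0 the A₁-part of u has surplus degree k • d, for n < 0 the A₂-part. For n = 0, covered
  -- in both branches, the two parts balance separately and one of them differs.
  obtain ⟨k, rfl | rfl⟩ := n.eq_nat_or_neg
  · rw [natCast_zsmul] at hn
    have e₁ := toNat (hx.symm.trans hn.symm)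
    rcases eq_or_ne k 0 with rfl | hk
    · have e₂ := toNat (hx'.symm.trans hn.symm)
      rw [zero_smul, add_zero] at e₁ e₂
      by_cases hr : restrict h₁ u = restrict h₁ v
      · refine lift₂ (H₂ _ _ e₂.symm fun hr' => hne ?_)
        rw [← extend_restrict_add h₁ h₂ hdisj hunion u, hr, hr',
          extend_restrict_add h₁ h₂ hdisj hunion]
      · exact lift₁ (H₁ _ _ e₁ hr)
    · exact lift₁ (H₁.exists_le_of_piHom_eq_add hw₁ hk e₁)
  · rw [neg_smul, natCast_zsmul] at hn
    have e₂ : piHom A₂ (restrict h₂ u) = piHom A₂ (restrict h₂ v) + k • d := by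
      apply toNat
      rw [← neg_sub, ← hx', ← hn, neg_neg]
    rcases eq_or_ne k 0 with rfl | hk
    · rw [zero_smul, add_zero] at e₂
      have e₁ : piHom A₁ (restrict h₁ u) = piHom A₁ (restrict h₁ v) := by
        apply toInt_injective
        rw [← sub_eq_zero, ← hx, ← hn, zero_smul, neg_zero]
      by_cases hr : restrict h₁ u = restrict h₁ v
      · refine lift₂ (H₂ _ _ e₂ fun hr' => hne ?_)
        rw [← extend_restrict_add h₁ h₂ hdisj hunion u, hr, hr',
          extend_restrict_add h₁ h₂ hdisj hunion]
      · exact lift₁ (H₁ _ _ e₁ hr)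
    · exact lift₂ (H₂.exists_le_of_piHom_eq_add hw₂ hk e₂)

theorem exists_piHom_eq_of_disjoint (hd : d ≠ 0) {A₁ A₂ : Finset (Fin r → ℕ)}
    (hdisj : Disjoint A₁ A₂) (h₁ : A₁ ⊆ A) (h₂ : A₂ ⊆ A)
    (hd₁ : d ∈ AddSubmonoid.closure (A₁ : Set (Fin r → ℕ)))
    (hd₂ : d ∈ AddSubmonoid.closure (A₂ : Set (Fin r → ℕ))) :
    ∃ u v : A → ℕ, piHom A u = piHom A v ∧ u ≠ v := by
  obtain ⟨w₁, hw₁⟩ := mem_closure_iff.mp hd₁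
  obtain ⟨w₂, hw₂⟩ := mem_closure_iff.mp hd₂
  refine ⟨extend A w₁, extend A w₂, by rw [piHom_extend h₁, piHom_extend h₂, hw₁, hw₂], ?_⟩
  intro h
  refine ne_zero_of_piHom_eq hd hw₁ ?_
  rw [← restrict_extend h₁ w₁, h]
  funext b
  rw [restrict_apply, extend, dif_neg (Finset.disjoint_left.mp hdisj b.2)]
  rfl

end AffineSemigroup

/-! ### The equivalence -/

open AffineSemigroup in
theorem mainTheorem1 {r : ℕ} (S : AddSubmonoid (Fin r → ℕ)) (A : Finset (Fin r → ℕ))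
    (hA : AffineSemigroup.MinimallyGenerates A S) (d : Fin r → ℕ) (hdS : d ∈ S) (hd : d ≠ 0) :
    List.TFAE [
      AffineSemigroup.betti S = {d},
      AffineSemigroup.circuits A = AffineSemigroup.distinctFactorizationPairs A d ∧
        AffineSemigroup.distinctFactorizationPairs A d = AffineSemigroup.graver A ∧
        (AffineSemigroup.graver A).Nonempty,
      ∃ S₁ S₂ : AddSubmonoid (Fin r → ℕ), AffineSemigroup.IsGluing A S₁ S₂ d ∧
        AffineSemigroup.betti S₁ ∪ AffineSemigroup.betti S₂ ⊆ {d}] := by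
  have h0 := hA.zero_notMem
  rw [hA.betti_eq_singleton_iff hd]
  have hpair : LiesAboveDegree A d → (∃ u v : A → ℕ, piHom A u = piHom A v ∧ u ≠ v) →
      ∃ z z' : A → ℕ, piHom A z = d ∧ piHom A z' = d ∧ z ≠ z' := by
    rintro h ⟨u, v, huv, hne⟩
    -- If `d` had at most one factorization, the trivial congruence would contain the kernel.
    by_contra! hz
    exact hne (h.kerCon_le hd (c := ⊥) (fun z z' hz1 hz2 => hz z z' hz1 hz2)
      (kerCon_iff.mpr huv))
  tfae_have 1 → 2 := by
    rintro ⟨h, hne⟩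
    obtain ⟨z, z', hz⟩ := hpair h hne
    have hG := h.distinctFactorizationPairs_eq_graver h0 hd
    exact ⟨h.circuits_eq h0 hd, hG, hG ▸ ⟨(z, z'), mem_distinctFactorizationPairs_iff.mpr hz⟩⟩
  tfae_have 2 → 1 := by
    -- The Graver equality and nonemptiness suffice here; the circuits play no role.
    rintro ⟨-, hG, ⟨⟨u, v⟩, huv⟩⟩
    refine ⟨liesAboveDegree_of_distinctFactorizationPairs_eq_graver hG, u, v, ?_⟩
    rw [← hG, mem_distinctFactorizationPairs_iff] at huv
    exact ⟨huv.1.trans huv.2.1.symm, huv.2.2⟩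
  tfae_have 1 → 3 := by
    rintro ⟨h, hne⟩
    obtain ⟨z, z', hz, hz', hzz⟩ := hpair h hne
    obtain ⟨A₁, A₂, h₁, h₂, hglue⟩ := h.exists_isGluing h0 hd hz hz' hzz
    exact ⟨_, _, hglue, Set.union_subset
      (((hA.of_subset h₁).betti_subset_iff hd).mpr (h.of_subset h₁))
      (((hA.of_subset h₂).betti_subset_iff hd).mpr (h.of_subset h₂))⟩
  tfae_have 3 → 1 := by
    rintro ⟨_, _, ⟨A₁, A₂, -, -, hdisj, hunion, rfl, rfl, hd₁, hd₂, -, hspan⟩, hb⟩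
    have h₁ : A₁ ⊆ A := hunion ▸ Finset.subset_union_left
    have h₂ : A₂ ⊆ A := hunion ▸ Finset.subset_union_right
    obtain ⟨hb₁, hb₂⟩ := Set.union_subset_iff.mp hb
    exact ⟨LiesAboveDegree.of_isGluing hdisj hunion hd₁ hd₂ hspan
        (((hA.of_subset h₁).betti_subset_iff hd).mp hb₁)
        (((hA.of_subset h₂).betti_subset_iff hd).mp hb₂),
      exists_piHom_eq_of_disjoint hd hdisj h₁ h₂ hd₁ hd₂⟩
  tfae_finish
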